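/- A field $K$ is called pythagorean if every sum of squares in $K$ is a square in $K$, and quadratically closed if every element of $K$ is a square in $K$. For a field $E$ with a fixed algebraic closure $\overline{E}$, let $E_{\mathrm{pyth}}$ be the union of all fields $E_n\subseteq\overline{E}$ occurring at the end of a finite chain $E=E_0\subseteq E_1\subseteq\dots\subseteq E_n$ with $E_{i+1}=E_i(s_i)$ and $s_i^2=a_i^2+b_i^2$ for some $a_i,b_i\in E_i$ (the pythagorean closure of $E$), and let $E_{\mathrm{quad}}$ be the union of all fields $E_n\subseteq\overline{E}$ occurring at the end of such a finite chain in which it is only required that $s_i^2\in E_i$ (the quadratic closure of $E$). A field $k$ is called hereditarily non-pythagorean (respectively, hereditarily non-quadratically closed) if every proper finite extension $L/k$ that is not purely inseparable is not pythagorean (respectively, not quadratically closed). Let $F$ be a number field, that is, a finite extension of $\mathbb{Q}$. Then $F_{\mathrm{pyth}}$ is hereditarily non-pythagorean and $F_{\mathrm{quad}}$ is hereditarily non-quadratically closed. -/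

import Mathlib

/-- A field is pythagorean if every sum of squares is a square. -/
def IsPythagorean (K : Type*) [Field K] : Prop :=
  ∀ a : K, IsSumSq a → IsSquare a

/-- A field is quadratically closed if every element is a square. -/
def IsQuadraticallyClosed (K : Type*) [Field K] : Prop :=
  ∀ a : K, IsSquare a

/-- Every proper finite extension of `k` that is not purely inseparable is non-pythagorean.
The extensions range over an arbitrary universe `v`. -/
def HereditarilyNonPythagorean.{v, u} (k : Type u) [Field k] : Prop :=
  ∀ (L : Type v) [Field L] [Algebra k L], FiniteDimensional k L → 1 < Module.finrank k L →
    ¬ IsPurelyInseparable k L → ¬ IsPythagorean L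

/-- Every proper finite extension of `k` that is not purely inseparable is not quadratically
closed. The extensions range over an arbitrary universe `v`. -/
def HereditarilyNonQuadraticallyClosed.{v, u} (k : Type u) [Field k] : Prop :=
  ∀ (L : Type v) [Field L] [Algebra k L], FiniteDimensional k L → 1 < Module.finrank k L →
    ¬ IsPurelyInseparable k L → ¬ IsQuadraticallyClosed L

section Closures

variable (E : Type*) (Ω : Type*) [Field E] [Field Ω] [Algebra E Ω]

/-- The subfields of `Ω` reached from `E` by a finite chain of steps `K ⊆ K(s)`, where `s` is a
square root of a sum of two squares of elements of `K`. -/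
inductive IsPythagoreanTower : IntermediateField E Ω → Prop
  | base : IsPythagoreanTower ⊥
  | step (K : IntermediateField E Ω) (a b s : Ω) (hK : IsPythagoreanTower K)
      (ha : a ∈ K) (hb : b ∈ K) (hs : s ^ 2 = a ^ 2 + b ^ 2) :
      IsPythagoreanTower ((IntermediateField.adjoin K {s}).restrictScalars E)

/-- The subfields of `Ω` reached from `E` by a finite chain of steps `K ⊆ K(s)`, where `s` is a
square root of an element of `K`. -/
inductive IsQuadraticTower : IntermediateField E Ω → Prop
  | base : IsQuadraticTower ⊥
  | step (K : IntermediateField E Ω) (a s : Ω) (hK : IsQuadraticTower K)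
      (ha : a ∈ K) (hs : s ^ 2 = a) :
      IsQuadraticTower ((IntermediateField.adjoin K {s}).restrictScalars E)

/-- The pythagorean closure of `E` in `Ω` (to be used with `Ω` an algebraic closure of `E`):
the direct limit of all finite pythagorean towers. The family is directed, so the supremum is
the union, see `mem_pythagoreanClosure`. -/
def pythagoreanClosure : IntermediateField E Ω :=
  ⨆ K : {K : IntermediateField E Ω // IsPythagoreanTower E Ω K}, K.1

/-- The quadratic closure of `E` in `Ω` (to be used with `Ω` an algebraic closure of `E`):
the direct limit of all finite quadratic towers. The family is directed, so the supremum is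
the union, see `mem_quadraticClosure`. -/
def quadraticClosure : IntermediateField E Ω :=
  ⨆ K : {K : IntermediateField E Ω // IsQuadraticTower E Ω K}, K.1

variable {E Ω}

theorem sup_restrictScalars_adjoin (K M : IntermediateField E Ω) (s : Ω) :
    K ⊔ (IntermediateField.adjoin M {s}).restrictScalars E =
      (IntermediateField.adjoin (K ⊔ M : IntermediateField E Ω) {s}).restrictScalars E := by
  rw [IntermediateField.restrictScalars_adjoin_eq_sup,
    IntermediateField.restrictScalars_adjoin_eq_sup, sup_assoc]

theorem IsPythagoreanTower.sup {K M : IntermediateField E Ω} (hK : IsPythagoreanTower E Ω K)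
    (hM : IsPythagoreanTower E Ω M) : IsPythagoreanTower E Ω (K ⊔ M) := by
  induction hM with
  | base => simpa using hK
  | step M a b s _ ha hb hs ih =>
    rw [sup_restrictScalars_adjoin]
    exact .step _ a b s ih ((le_sup_right : M ≤ K ⊔ M) ha) ((le_sup_right : M ≤ K ⊔ M) hb) hs

theorem IsQuadraticTower.sup {K M : IntermediateField E Ω} (hK : IsQuadraticTower E Ω K)
    (hM : IsQuadraticTower E Ω M) : IsQuadraticTower E Ω (K ⊔ M) := by
  induction hM with
  | base => simpa using hK
  | step M a s _ ha hs ih =>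
    rw [sup_restrictScalars_adjoin]
    exact .step _ a s ih ((le_sup_right : M ≤ K ⊔ M) ha) hs

theorem mem_pythagoreanClosure {x : Ω} :
    x ∈ pythagoreanClosure E Ω ↔ ∃ K, IsPythagoreanTower E Ω K ∧ x ∈ K := by
  have : Nonempty {K : IntermediateField E Ω // IsPythagoreanTower E Ω K} := ⟨⟨⊥, .base⟩⟩
  have hdir : Directed (· ≤ ·)
      (fun K : {K : IntermediateField E Ω // IsPythagoreanTower E Ω K} => K.1) :=
    fun K M => ⟨⟨K.1 ⊔ M.1, K.2.sup M.2⟩, le_sup_left, le_sup_right⟩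
  rw [pythagoreanClosure, ← SetLike.mem_coe, IntermediateField.coe_iSup_of_directed hdir]
  simp

theorem mem_quadraticClosure {x : Ω} :
    x ∈ quadraticClosure E Ω ↔ ∃ K, IsQuadraticTower E Ω K ∧ x ∈ K := by
  have : Nonempty {K : IntermediateField E Ω // IsQuadraticTower E Ω K} := ⟨⟨⊥, .base⟩⟩
  have hdir : Directed (· ≤ ·)
      (fun K : {K : IntermediateField E Ω // IsQuadraticTower E Ω K} => K.1) :=
    fun K M => ⟨⟨K.1 ⊔ M.1, K.2.sup M.2⟩, le_sup_left, le_sup_right⟩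
  rw [quadraticClosure, ← SetLike.mem_coe, IntermediateField.coe_iSup_of_directed hdir]
  simp

end Closures

universe v u w

/-! ### Arithmetic of number fields: primes with `p`-adic embeddings, and a non-square -/

section

open Polynomial

/-! Both closures are stable under `Gal(Ω/F)`, and stability alone suffices. Let `K` be stable, `L =
K(θ)` a proper finite pythagorean extension, and `h` an automorphism over `K` with `h θ ≠ θ`. Each
`(θ + t)² + 1` is some `γ²` in `L`, and a commutator argument (`apply_mul_apply_eq_of_sq_mem`) puts
`γ * h γ` in the number field `N = F(θ, h θ, i)`. So `((θ + t)² + 1)((h θ + t)² + 1)` is a square in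
`N` for every integer `t`. This is impossible: `N` embeds in some `ℚ_p`, where a suitable `t` gives
the product valuation one (`NumberField.exists_not_isSquare_mul`). -/

theorem Polynomial.exists_prime_dvd_eval (f : ℤ[X]) (hf : 0 < f.natDegree) {D : ℤ} (hD : D ≠ 0) :
    ∃ p : ℕ, p.Prime ∧ ¬ (p : ℤ) ∣ D ∧ ∃ a : ℤ, (p : ℤ) ∣ f.eval a := by
  have avoid : ∀ (s : Finset ℤ) (g : ℤ → ℤ), g.Injective → ∃ x, f.eval (g x) ∉ s := by
    intro s g hg
    by_contra! h
    have hP : ∏ c ∈ s, (f - C c) ≠ 0 := Finset.prod_ne_zero_iff.mpr fun c _ hc => by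
      rw [sub_eq_zero.mp hc, natDegree_C] at hf
      exact hf.false
    refine hP (eq_zero_of_infinite_isRoot _ ((Set.infinite_range_of_injective hg).mono ?_))
    rintro _ ⟨x, rfl⟩
    rw [Set.mem_ofPred_eq, IsRoot.def, eval_prod]
    exact Finset.prod_eq_zero (h x) (by simp)
  obtain ⟨a, ha⟩ := avoid {0} id Function.injective_id
  set c := f.eval a with hc
  have hc0 : c ≠ 0 := by simpa using ha
  -- Euclid's trick: modulo `c * D` the value stays `c`, so it equals `c * (1 + D * q)`; avoiding
  -- `±c` makes the cofactor, which is prime to `D`, a nonunit.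
  obtain ⟨x, hx⟩ := avoid {c, -c} (fun x => a + c * D * x) (fun x y h => by
    simpa [hc0, hD] using h)
  obtain ⟨q, hq⟩ : c * D ∣ f.eval (a + c * D * x) - c :=
    (Dvd.intro x (by ring)).trans (sub_dvd_eval_sub (a + c * D * x) a f)
  have he : f.eval (a + c * D * x) = c * (1 + D * q) := by linear_combination hq
  have hu : (1 + D * q).natAbs ≠ 1 := by
    intro h
    rcases Int.natAbs_eq_iff.mp h with h | h
    · exact hx (by simp [he, h])
    · exact hx (by simp [he, h])
  obtain ⟨p, hp, hpd⟩ := Nat.exists_prime_and_dvd hu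
  have hpd' : (p : ℤ) ∣ 1 + D * q := Int.natCast_dvd.mpr hpd
  refine ⟨p, hp, fun h => ?_, _, he ▸ hpd'.mul_left c⟩
  have : (p : ℤ) ∣ 1 := (dvd_add_left (h.mul_right q)).mp hpd'
  exact hp.one_lt.ne' (by exact_mod_cast Int.natAbs_dvd_natAbs.mpr this |> Nat.dvd_one.mp)

/-- A root modulo `p` of an integral multiple `f` of the minimal polynomial of a generator lifts by
Hensel. Separability gives a Bézout identity for `f` and `f'` with integer constant `a * b`; when
`p` does not divide it, the root is simple. -/
theorem NumberField.exists_ringHom_padic (N : Type*) [Field N] [NumberField N] {D : ℤ}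
    (hD : D ≠ 0) : ∃ (p : ℕ) (_ : Fact p.Prime), ¬ (p : ℤ) ∣ D ∧ Nonempty (N →+* ℚ_[p]) := by
  let pb := Field.powerBasisOfFiniteOfSeparable ℚ N
  set m := minpoly ℚ pb.gen
  have hirr : Irreducible m := minpoly.irreducible pb.isIntegral_gen
  obtain ⟨d, hd, hf⟩ := IsLocalization.integerNormalization_spec (nonZeroDivisors ℤ) m
  set f := IsLocalization.integerNormalization (nonZeroDivisors ℤ) m
  have hd0 : (d : ℚ) ≠ 0 := by exact_mod_cast nonZeroDivisors.ne_zero hd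
  have hf' : f.map (algebraMap ℤ ℚ) = C (d : ℚ) * m := by
    rw [hf, zsmul_eq_mul, C_eq_intCast]
  have hdeg : 0 < f.natDegree := by
    rw [← natDegree_map_eq_of_injective (algebraMap ℤ ℚ).injective_int, hf', natDegree_C_mul hd0]
    exact hirr.natDegree_pos
  have hcop : IsCoprime (f.map (algebraMap ℤ ℚ)) (derivative f |>.map (algebraMap ℤ ℚ)) := by
    have hu : IsUnit (C (d : ℚ)) := isUnit_C.mpr hd0.isUnit
    rw [← derivative_map, hf', derivative_C_mul]
    exact (isCoprime_mul_unit_left hu m (derivative m)).mpr hirr.separable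
  obtain ⟨u, v, huv⟩ := hcop
  obtain ⟨a, ha, hu⟩ := IsLocalization.integerNormalization_spec (nonZeroDivisors ℤ) u
  obtain ⟨b, hb, hv⟩ := IsLocalization.integerNormalization_spec (nonZeroDivisors ℤ) v
  set U := IsLocalization.integerNormalization (nonZeroDivisors ℤ) u
  set V := IsLocalization.integerNormalization (nonZeroDivisors ℤ) v
  have ha0 := nonZeroDivisors.ne_zero ha
  have hb0 := nonZeroDivisors.ne_zero hb
  have key : C b * U * f + C a * V * derivative f = C (a * b) := by
    apply map_injective (algebraMap ℤ ℚ) (algebraMap ℤ ℚ).injective_int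
    rw [Polynomial.map_add, Polynomial.map_mul, Polynomial.map_mul, Polynomial.map_mul,
      Polynomial.map_mul, hu, hv, map_C, map_C, map_C, map_mul, C_mul, zsmul_eq_mul, zsmul_eq_mul,
      eq_intCast, eq_intCast, C_eq_intCast, C_eq_intCast]
    linear_combination (a * b : ℚ[X]) * huv
  obtain ⟨p, hp, hpD, x, hx⟩ := f.exists_prime_dvd_eval hdeg (mul_ne_zero hD (mul_ne_zero ha0 hb0))
  have : Fact p.Prime := ⟨hp⟩
  refine ⟨p, this, fun h => hpD (h.mul_right _), ?_⟩
  have hx' : ¬ (p : ℤ) ∣ (derivative f).eval x := fun h => hpD <| Dvd.dvd.mul_left (by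
    have := congrArg (eval x) key
    simp only [eval_add, eval_mul, eval_C] at this
    rw [← this]
    exact dvd_add (hx.mul_left _) (h.mul_left _)) _
  have hn : ∀ g : ℤ[X], aeval (x : ℤ_[p]) g = ((g.eval x : ℤ) : ℤ_[p]) := fun g => by
    simpa using aeval_algebraMap_apply ℤ_[p] x g
  obtain ⟨z, hz, -⟩ := hensels_lemma (F := f) (a := (x : ℤ_[p])) (by
    have h1 : ‖(((derivative f).eval x : ℤ) : ℤ_[p])‖ = 1 :=
      PadicInt.norm_intCast_eq_one_iff.mpr
        ((Nat.prime_iff_prime_int.mp hp).coprime_iff_not_dvd.mpr hx').symm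
    rw [hn, hn, h1, one_pow, PadicInt.norm_int_lt_one_iff_dvd]
    exact hx)
  refine ⟨(pb.lift (z : ℚ_[p]) ?_ : N →ₐ[ℚ] ℚ_[p]).toRingHom⟩
  have hz' : aeval (z : ℚ_[p]) (f.map (algebraMap ℤ ℚ)) = 0 := by
    rw [aeval_map_algebraMap]
    have := aeval_algebraMap_apply ℚ_[p] z f
    rw [hz, map_zero] at this
    exact this
  rw [hf', map_mul, aeval_C] at hz'
  exact (mul_eq_zero.mp hz').resolve_left (by simpa using hd0)

theorem NumberField.exists_norm_ringHom_padic_le_one {N : Type*} [Field N] [NumberField N] (x : N) :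
    ∃ D : ℤ, D ≠ 0 ∧ ∀ (p : ℕ) [Fact p.Prime], ¬ (p : ℤ) ∣ D → ∀ σ : N →+* ℚ_[p], ‖σ x‖ ≤ 1 := by
  obtain ⟨D, hD, hx⟩ : ∃ D : ℤ, D ≠ 0 ∧ IsIntegral ℤ (D • x) :=
    ((IsFractionRing.isAlgebraic_iff ℤ ℚ N).mpr (.of_finite ℚ x)).exists_integral_multiple
  refine ⟨D, hD, fun p _ hp σ => ?_⟩
  have h1 : ‖(D : ℚ_[p])‖ = 1 := le_antisymm (Padic.norm_int_le_one D)
    (not_lt.mp fun h => hp (Padic.norm_intCast_lt_one_iff.mp h))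
  obtain ⟨y, hy⟩ := IsIntegrallyClosed.isIntegral_iff.mp
    ((hx.map σ.toIntAlgHom).tower_top (A := ℤ_[p]))
  have h2 : (y : ℚ_[p]) = D * σ x := by simpa using hy
  rw [show ‖σ x‖ = ‖(y : ℚ_[p])‖ by rw [h2, norm_mul, h1, one_mul]]
  exact y.norm_le_one

theorem NumberField.exists_norm_ringHom_padic_eq_one {N : Type*} [Field N] [NumberField N] {x : N}
    (hx : x ≠ 0) : ∃ D : ℤ, D ≠ 0 ∧
      ∀ (p : ℕ) [Fact p.Prime], ¬ (p : ℤ) ∣ D → ∀ σ : N →+* ℚ_[p], ‖σ x‖ = 1 := by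
  obtain ⟨D, hD, h⟩ := NumberField.exists_norm_ringHom_padic_le_one x
  obtain ⟨D', hD', h'⟩ := NumberField.exists_norm_ringHom_padic_le_one x⁻¹
  refine ⟨D * D', mul_ne_zero hD hD', fun p _ hp σ => ?_⟩
  refine le_antisymm (h p (fun H => hp (H.mul_right _)) σ) ?_
  have := h' p (fun H => hp (H.mul_left _)) σ
  rw [map_inv₀, norm_inv] at this
  exact (inv_le_one₀ (norm_pos_iff.mpr ((map_ne_zero σ).mpr hx))).mp this

theorem Padic.exists_norm_add_intCast_eq_inv {p : ℕ} [Fact p.Prime] {x : ℚ_[p]} (hx : ‖x‖ ≤ 1) :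
    ∃ t : ℤ, ‖x + t‖ = (p : ℝ)⁻¹ := by
  obtain ⟨n, -, hn⟩ := PadicInt.exists_mem_range (⟨x, hx⟩ : ℤ_[p])
  have hn' : ‖x - (n : ℚ_[p])‖ < 1 := PadicInt.mem_nonunits.mp hn
  have hle : ‖x - (n : ℚ_[p])‖ ≤ (p : ℝ)⁻¹ := by
    simpa using (Padic.norm_lt_pow_iff_norm_le_pow_sub_one (x - (n : ℚ_[p])) 0).mp (by simpa using hn')
  rcases hle.eq_or_lt with h | h
  · exact ⟨-n, by simpa [sub_eq_add_neg] using h⟩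
  -- If the valuation exceeds one, adding `p` brings it down to exactly one.
  · refine ⟨-n + p, ?_⟩
    have : ‖(x - n) + (p : ℚ_[p])‖ = max ‖x - (n : ℚ_[p])‖ ‖(p : ℚ_[p])‖ :=
      Padic.add_eq_max_of_ne (by rw [Padic.norm_p]; exact h.ne)
    rw [Padic.norm_p, max_eq_right h.le] at this
    rw [← this]
    congr 1
    push_cast
    ring

theorem Padic.not_isSquare_of_norm_eq_inv {p : ℕ} [hp : Fact p.Prime] {x : ℚ_[p]}
    (hx : ‖x‖ = (p : ℝ)⁻¹) : ¬ IsSquare x := by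
  rintro ⟨y, rfl⟩
  have hp1 : (1 : ℝ) < p := by exact_mod_cast hp.out.one_lt
  have hy : y ≠ 0 := by
    rintro rfl
    simp at hx
    exact hp.out.ne_zero (by exact_mod_cast hx.symm)
  rw [norm_mul, Padic.norm_eq_zpow_neg_valuation hy, ← zpow_add₀ (by positivity), ← zpow_neg_one] at hx
  have := zpow_right_injective₀ (by positivity) hp1.ne' hx
  omega

theorem NumberField.exists_not_isSquare_mul {N : Type*} [Field N] [NumberField N] {θ θ' i : N}
    (hi : i ^ 2 = -1) (hθ : θ ≠ θ') :
    ∃ t : ℤ, ¬ IsSquare (((θ + t) ^ 2 + 1) * ((θ' + t) ^ 2 + 1)) := by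
  have hi0 : i ≠ 0 := by rintro rfl; norm_num at hi
  -- This keeps `θ + i` distinct from `θ' - i`. It cannot fail for both `i` and `-i`, since then `4
  -- * i = 0`.
  wlog hd : θ' - θ ≠ 2 * i generalizing i
  · refine this (i := -i) (by simpa using hi) (by simpa using hi0) fun h => ?_
    have : i * 4 = 0 := by linear_combination h - not_ne_iff.mp hd
    simp [hi0] at this
  obtain ⟨D, hD, h⟩ := NumberField.exists_norm_ringHom_padic_le_one (θ + i)
  obtain ⟨D₁, hD₁, h₁⟩ := NumberField.exists_norm_ringHom_padic_eq_one
    (mul_ne_zero (two_ne_zero' N) hi0 |> neg_ne_zero.mpr)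
  obtain ⟨D₂, hD₂, h₂⟩ := NumberField.exists_norm_ringHom_padic_eq_one (sub_ne_zero.mpr hθ.symm)
  obtain ⟨D₃, hD₃, h₃⟩ := NumberField.exists_norm_ringHom_padic_eq_one (sub_ne_zero.mpr hd)
  obtain ⟨p, hp, hpD, ⟨σ⟩⟩ := NumberField.exists_ringHom_padic N
    (mul_ne_zero (mul_ne_zero hD hD₁) (mul_ne_zero hD₂ hD₃))
  replace h := h p (fun H => hpD ((H.mul_right _).mul_right _)) σ
  replace h₁ := h₁ p (fun H => hpD ((H.mul_left _).mul_right _)) σ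
  replace h₂ := h₂ p (fun H => hpD ((H.mul_right _).mul_left _)) σ
  replace h₃ := h₃ p (fun H => hpD ((H.mul_left _).mul_left _)) σ
  obtain ⟨t, ht⟩ := Padic.exists_norm_add_intCast_eq_inv h
  refine ⟨t, fun hsq => Padic.not_isSquare_of_norm_eq_inv (p := p) ?_ (hsq.map σ)⟩
  have hunit : ∀ y : N, ‖σ y‖ = 1 → ‖σ (θ + i + t + y)‖ = 1 := by
    intro y hy
    have hlt : ‖σ (θ + i) + t‖ < ‖σ y‖ := by
      rw [ht, hy]
      exact inv_lt_one_of_one_lt₀ (by exact_mod_cast hp.out.one_lt)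
    rw [map_add, map_add, map_intCast, Padic.add_eq_max_of_ne hlt.ne, max_eq_right hlt.le, hy]
  -- The factors are `θ ± i + t` and `θ' ± i + t`, written as shifts of `θ + i + t`. That one has
  -- valuation one; the shifts by `p`-adic units are units.
  have hfac : ((θ + t) ^ 2 + 1) * ((θ' + t) ^ 2 + 1) = (θ + i + t) * (θ + i + t + -(2 * i)) *
      (θ + i + t + (θ' - θ)) * (θ + i + t + (θ' - θ - 2 * i)) := by
    linear_combination ((θ + t) ^ 2 + (θ' + t) ^ 2 + 1 - i ^ 2) * hi
  rw [hfac, map_mul, map_mul, map_mul, norm_mul, norm_mul, norm_mul, hunit _ h₁, hunit _ h₂,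
    hunit _ h₃, map_add, map_intCast, ht]
  ring

end

/-! ### Galois descent from normal extensions -/

section

open IntermediateField

variable {F Ω : Type*} [Field F] [Field Ω] [Algebra F Ω]

theorem IsPythagoreanTower.map {K : IntermediateField F Ω} (hK : IsPythagoreanTower F Ω K)
    (g : Ω ≃ₐ[F] Ω) : IsPythagoreanTower F Ω (K.map g.toAlgHom) := by
  induction hK with
  | base => simpa using IsPythagoreanTower.base
  | step K a b s _ ha hb hs ih =>
    rw [restrictScalars_adjoin_eq_sup, IntermediateField.map_sup, adjoin_map, Set.image_singleton,
      ← restrictScalars_adjoin_eq_sup]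
    exact .step _ (g a) (g b) _ ih ⟨a, ha, rfl⟩ ⟨b, hb, rfl⟩ (by simpa using congrArg g hs)

theorem IsQuadraticTower.map {K : IntermediateField F Ω} (hK : IsQuadraticTower F Ω K)
    (g : Ω ≃ₐ[F] Ω) : IsQuadraticTower F Ω (K.map g.toAlgHom) := by
  induction hK with
  | base => simpa using IsQuadraticTower.base
  | step K a s _ ha hs ih =>
    rw [restrictScalars_adjoin_eq_sup, IntermediateField.map_sup, adjoin_map, Set.image_singleton,
      ← restrictScalars_adjoin_eq_sup]
    exact .step _ (g a) _ ih ⟨a, ha, rfl⟩ (by simpa using congrArg g hs)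

theorem apply_mem_pythagoreanClosure (g : Ω ≃ₐ[F] Ω) {x : Ω} (hx : x ∈ pythagoreanClosure F Ω) :
    g x ∈ pythagoreanClosure F Ω := by
  obtain ⟨K, hK, hx⟩ := mem_pythagoreanClosure.mp hx
  exact mem_pythagoreanClosure.mpr ⟨_, hK.map g, x, hx, rfl⟩

theorem apply_mem_quadraticClosure (g : Ω ≃ₐ[F] Ω) {x : Ω} (hx : x ∈ quadraticClosure F Ω) :
    g x ∈ quadraticClosure F Ω := by
  obtain ⟨K, hK, hx⟩ := mem_quadraticClosure.mp hx
  exact mem_quadraticClosure.mpr ⟨_, hK.map g, x, hx, rfl⟩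

/-- If `g` fixes `θ` and `h θ`, where `h` fixes the normal extension `K` pointwise, then the
commutator of `g` and `h` fixes `K(θ)`, whence `g` changes the signs of `γ` and `h γ`
simultaneously. -/
theorem apply_mul_apply_eq_of_sq_mem {K : IntermediateField F Ω}
    (hK : ∀ (g : Ω ≃ₐ[F] Ω), ∀ x ∈ K, g x ∈ K) {θ γ : Ω} (hγ : γ ∈ K⟮θ⟯)
    (hγ2 : γ ^ 2 ∈ F⟮θ⟯) {g h : Ω ≃ₐ[F] Ω} (hh : ∀ x ∈ K, h x = x)
    (hg : g θ = θ) (hg' : g (h θ) = h θ) : g (γ * h γ) = γ * h γ := by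
  -- On `K` they commute because `g` preserves `K` and `h` is trivial there.
  have hc : ∀ y ∈ K⟮θ⟯, g (h y) = h (g y) := by
    intro y hy
    induction hy using adjoin_induction with
    | mem x hx => rw [Set.mem_singleton_iff.mp hx, hg, hg']
    | algebraMap x =>
      have hx : (algebraMap K Ω x) ∈ K := x.2
      rw [hh _ hx, hh _ (hK g _ hx)]
    | add x y _ _ hx hy => simp [hx, hy]
    | inv x _ hx => simp [hx]
    | mul x y _ _ hx hy => simp [hx, hy]
  have hgγ2 : ∀ y ∈ F⟮θ⟯, g y = y := by
    intro y hy
    induction hy using adjoin_induction with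
    | mem x hx => rw [Set.mem_singleton_iff.mp hx, hg]
    | algebraMap x => exact g.commutes x
    | add x y _ _ hx hy => simp [hx, hy]
    | inv x _ hx => simp [hx]
    | mul x y _ _ hx hy => simp [hx, hy]
  have hsq : g γ ^ 2 = γ ^ 2 := by rw [← map_pow, hgγ2 _ hγ2]
  rw [map_mul, hc γ hγ]
  rcases sq_eq_sq_iff_eq_or_eq_neg.mp hsq with e | e <;> simp [e]

theorem hereditarilyNonPythagorean_of_normal [NumberField F] [IsAlgClosure F Ω]
    {K : IntermediateField F Ω} (hK : ∀ (g : Ω ≃ₐ[F] Ω), ∀ x ∈ K, g x ∈ K) :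
    HereditarilyNonPythagorean.{v} K := by
  intro L _ _ _ hL _ hpyth
  have : IsAlgClosed Ω := IsAlgClosure.isAlgClosed F
  have : Algebra.IsAlgebraic F Ω := IsAlgClosure.isAlgebraic
  have : CharZero Ω := charZero_of_injective_algebraMap (algebraMap F Ω).injective
  have : Algebra.IsAlgebraic K Ω := Algebra.IsAlgebraic.tower_top (K := F) K
  have : IsGalois F Ω := {}
  have : IsGalois K Ω := {}
  let φ : L →ₐ[K] Ω := IsAlgClosed.lift
  obtain ⟨θ₀, hθ₀⟩ := Field.exists_primitive_element K L
  set θ := φ θ₀ with hθdef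
  have hφ : ∀ x, φ x ∈ K⟮θ⟯ := by
    intro x
    have hx : φ x ∈ K⟮θ₀⟯.map φ := ⟨x, hθ₀ ▸ mem_top, rfl⟩
    rwa [adjoin_map, Set.image_singleton] at hx
  have hθ : θ ∉ (⊥ : IntermediateField K Ω) := by
    rintro ⟨x, hx⟩
    have : θ₀ ∈ (⊥ : IntermediateField K L) := ⟨x, φ.injective (by simpa using hx)⟩
    rw [← adjoin_simple_eq_bot_iff, hθ₀] at this
    exact hL.ne' (bot_eq_top_iff_finrank_eq_one.mp this.symm)
  obtain ⟨h, hh⟩ : ∃ h : Ω ≃ₐ[K] Ω, h θ ≠ θ := by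
    by_contra! H
    exact hθ ((InfiniteGalois.mem_bot_iff_fixed θ).mpr H)
  obtain ⟨i, hi⟩ := IsAlgClosed.exists_pow_nat_eq (-1 : Ω) (n := 2) (by norm_num)
  let N : IntermediateField F Ω := adjoin F {θ, h θ, i}
  have : FiniteDimensional F N :=
    finiteDimensional_adjoin fun x _ => (Algebra.IsAlgebraic.isAlgebraic x).isIntegral
  have : NumberField N := NumberField.of_module_finite F N
  have hmem : ∀ x ∈ ({θ, h θ, i} : Set Ω), x ∈ N := fun x hx => subset_adjoin F _ hx
  obtain ⟨t, ht⟩ := NumberField.exists_not_isSquare_mul (N := N) (θ := ⟨θ, hmem _ (by simp)⟩)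
    (θ' := ⟨h θ, hmem _ (by simp)⟩) (i := ⟨i, hmem _ (by simp)⟩) (Subtype.ext hi)
    (fun H => hh (congrArg Subtype.val H).symm)
  obtain ⟨γ₀, hγ₀⟩ := hpyth ((θ₀ + t) ^ 2 + 1) (((IsSquare.sq _).isSumSq).add IsSquare.one.isSumSq)
  have hγ : (θ + t) ^ 2 + 1 = φ γ₀ ^ 2 := by
    rw [sq (φ γ₀), ← map_mul, ← hγ₀]
    simp [hθdef]
  have hγ' : (h θ + t) ^ 2 + 1 = h (φ γ₀) ^ 2 := by simpa using congrArg h hγ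
  -- By Galois correspondence, it is enough that every `g` fixing `N` fixes the product.
  have hfix : φ γ₀ * h (φ γ₀) ∈ N := by
    rw [← InfiniteGalois.fixedField_fixingSubgroup N]
    rintro ⟨g, hg⟩
    have hg : ∀ x ∈ N, g x = x := (mem_fixingSubgroup_iff N g).mp hg
    refine apply_mul_apply_eq_of_sq_mem (h := h.restrictScalars F) hK (hφ γ₀) ?_
      (fun x hx => h.commutes ⟨x, hx⟩) (hg _ (hmem _ (by simp))) (hg _ (hmem _ (by simp)))
    rw [← hγ]
    exact add_mem (pow_mem (add_mem (mem_adjoin_simple_self F θ) (intCast_mem _ t)) 2) (one_mem _)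
  refine ht ⟨⟨_, hfix⟩, Subtype.ext ?_⟩
  simp only [MulMemClass.mk_mul_mk]
  change ((θ + t) ^ 2 + 1) * ((h θ + t) ^ 2 + 1) = _
  rw [hγ, hγ']
  ring

end

theorem IsQuadraticallyClosed.isPythagorean {K : Type*} [Field K] (h : IsQuadraticallyClosed K) :
    IsPythagorean K :=
  fun a _ => h a

theorem HereditarilyNonPythagorean.hereditarilyNonQuadraticallyClosed {k : Type u} [Field k]
    (h : HereditarilyNonPythagorean.{v} k) : HereditarilyNonQuadraticallyClosed.{v} k :=
  fun L _ _ hfin hdeg hins hquad => h L hfin hdeg hins hquad.isPythagorean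

theorem mainTheorem2 (F : Type u) [Field F] [NumberField F]
    (Ω : Type w) [Field Ω] [Algebra F Ω] [IsAlgClosure F Ω] :
    HereditarilyNonPythagorean.{v} (pythagoreanClosure F Ω) ∧
      HereditarilyNonQuadraticallyClosed.{v} (quadraticClosure F Ω) :=
  ⟨hereditarilyNonPythagorean_of_normal fun g _ => apply_mem_pythagoreanClosure g,
    (hereditarilyNonPythagorean_of_normal
      fun g _ => apply_mem_quadraticClosure g).hereditarilyNonQuadraticallyClosed⟩
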